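/- Let $q>2$, $r\in[0,1)$ and $C_0>0$. There is a constant $C=C(q,r,C_0)\in(0,\infty)$, depending only on $q,r,C_0$, such that the following holds. Let $(M_p)_{p\ge 1}$ be real numbers with $M_p\to\infty$ as $p\to\infty$, and let $\mathcal G_r(M_p)$ be the class of real symmetric $p\times p$ matrices $A=(a_{jk})$ with spectral norm $\rho(A)\le C_0$ and $\max_{k\le p}\sum_{j=1}^p|a_{jk}|^r\le M_p$ (with the convention $0^0=0$ when $r=0$). For every $p\ge1$ and all iid real random variables $X_1,\dots,X_p$ with $\mathbb E X_1=0$, $\mathbb E X_1^2=1$ and $\kappa_{2q}:=(\mathbb E|X_1|^{2q})^{1/(2q)}<\infty$, writing $\mathbf x=(X_1,\dots,X_p)^\top$, one has $$\sup_{A\in\mathcal G_r(M_p)}\mathbb E\,|\mathbf x^\top A\mathbf x-\operatorname{tr}(A)|^q\le C(q,r,C_0)\,\kappa_{2q}^{2q}\,\bigl(p^{q/2}+p^{1/2}M_p^{q/2}\bigr).$$ -/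

import Mathlib

open MeasureTheory ProbabilityTheory Filter
open scoped ENNReal Matrix

noncomputable section

/-- The power `|a|^r` for `r ≥ 0`, with the convention usual for strong `ℓ^r`-balls that a zero
entry contributes `0` also when `r = 0` (so that `∑ |a_j|^0` counts the nonzero entries). -/
def absPow (a r : ℝ) : ℝ := if a = 0 then 0 else |a| ^ r

/-- The spectral norm `ρ(A)`: the operator norm of `A` on Euclidean space. -/
def spectralNorm2 {p : ℕ} (A : Matrix (Fin p) (Fin p) ℝ) : ℝ :=
  ‖Matrix.toEuclideanCLM (n := Fin p) (𝕜 := ℝ) A‖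

/-- The class of symmetric `p × p` matrices with `ρ(A) ≤ C₀` all of whose columns satisfy
`∑_j |a_jk|^r ≤ M`. -/
def sparseClass (p : ℕ) (r C₀ M : ℝ) : Set (Matrix (Fin p) (Fin p) ℝ) :=
  {A | A.IsSymm ∧ spectralNorm2 A ≤ C₀ ∧ ∀ k : Fin p, ∑ j : Fin p, absPow (A j k) r ≤ M}

/-- The `L^w` norm `‖X‖_w = (E|X|^w)^{1/w}` of a real random variable in `L^w`. -/
def momentNorm {Ω : Type*} [MeasurableSpace Ω] (μ : Measure Ω) (w : ℝ) (X : Ω → ℝ) : ℝ :=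
  (∫ ω, |X ω| ^ w ∂μ) ^ (1 / w)

/-- The expectation `E|xᵀ A x - tr A|^q` for `x = (X_1, …, X_p)ᵀ`, with values in `[0, ∞]`. -/
def quadFormMoment {Ω : Type*} [MeasurableSpace Ω] (μ : Measure Ω) {p : ℕ} (X : Fin p → Ω → ℝ)
    (A : Matrix (Fin p) (Fin p) ℝ) (q : ℝ) : ℝ≥0∞ :=
  ∫⁻ ω, ENNReal.ofReal (|(fun j => X j ω) ⬝ᵥ (A *ᵥ (fun j => X j ω)) - A.trace| ^ q) ∂μ

end

/-! Reveal the coordinates one at a time: the centred quadratic form is then a martingale, and for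
$q>2$ squared $L^q$ norms of martingale increments add up to a constant (`exists_sq_lpNorm_add_le`,
the 2-smoothness of $L^q$). The increment from $X_i$ is $A_{ii}(X_i^2-1)$ plus $X_i$ times a linear
form in the earlier variables. The latter is controlled by the same inequality in $L^{2q}$
(`exists_sq_lpNorm_sum_mul_le`).

Summing gives $\|x^\top Ax-\operatorname{tr}A\|_q^2\le K\kappa^4\|A\|_F^2$
(`exists_sq_lpNorm_quadForm_le`). Each column of $A$ has Euclidean norm at most $\rho(A)\le C_0$, so
$\|A\|_F^2\le pC_0^2$. The power $q/2$ yields the summand $p^{q/2}$, which alone suffices. -/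

/-! ### Scalar inequalities for powers. -/

/-- The tangent line inequality for `x ↦ x ^ p` at `1 + t`, evaluated at `1`. -/
lemma one_add_rpow_le_one_add_mul_rpow {p t : ℝ} (hp : 1 ≤ p) (ht : -1 < t) :
    (1 + t) ^ p ≤ 1 + p * t * (1 + t) ^ (p - 1) := by
  have h1 : 0 < 1 + t := by linarith
  -- Bernoulli's inequality at $s=-t/(1+t)$, chosen so that $1+s=(1+t)^{-1}$.
  have hs : -1 ≤ -t / (1 + t) := by
    rw [le_div_iff₀ h1]; linarith
  have hB := one_add_mul_self_le_rpow_one_add hs hp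
  have e1 : 1 + -t / (1 + t) = (1 + t)⁻¹ := by field_simp; ring
  rw [e1, Real.inv_rpow h1.le] at hB
  have hpos : 0 < (1 + t) ^ p := Real.rpow_pos_of_pos h1 p
  have h2 := mul_le_mul_of_nonneg_right hB hpos.le
  rw [inv_mul_cancel₀ hpos.ne'] at h2
  rw [Real.rpow_sub_one h1.ne']
  have e2 : (1 + p * (-t / (1 + t))) * (1 + t) ^ p
      = (1 + t) ^ p - p * t * ((1 + t) ^ p / (1 + t)) := by
    field_simp
    ring
  linarith

lemma one_add_rpow_le_quadratic {q t : ℝ} (hq : 2 ≤ q) (ht : |t| ≤ 1 / 2) :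
    (1 + t) ^ q ≤ 1 + q * t + q * (q - 1) * 2 ^ q * t ^ 2 := by
  obtain ⟨ht1, ht2⟩ := abs_le.1 ht
  have h1 := one_add_rpow_le_one_add_mul_rpow (p := q) (t := t) (by linarith) (by linarith)
  have h2q : (1 : ℝ) ≤ 2 ^ q := Real.one_le_rpow (by norm_num) (by linarith)
  -- The error left by the tangent inequality is quadratic in $t$: bound $(1+t)^{q-1}-1$ above for
  -- $t\ge0$ and below for $t\le0$.
  have key : t * ((1 + t) ^ (q - 1) - 1) ≤ (q - 1) * 2 ^ q * t ^ 2 := by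
    rcases le_total 0 t with h | h
    · have h3 := one_add_rpow_le_one_add_mul_rpow (p := q - 1) (t := t) (by linarith) (by linarith)
      have h4 : (1 + t) ^ (q - 1 - 1) ≤ 2 ^ q :=
        (Real.rpow_le_rpow (by linarith) (by linarith : 1 + t ≤ 2) (by linarith)).trans
          (Real.rpow_le_rpow_of_exponent_le (by norm_num) (by linarith))
      have h5 : (1 + t) ^ (q - 1) - 1 ≤ (q - 1) * t * 2 ^ q := by
        have := mul_le_mul_of_nonneg_left h4 (mul_nonneg (by linarith : 0 ≤ q - 1) h)
        linarith
      have := mul_le_mul_of_nonneg_left h5 h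
      linarith
    · have h3 := one_add_mul_self_le_rpow_one_add (s := t) (by linarith) (p := q - 1) (by linarith)
      have h4 : t * ((1 + t) ^ (q - 1) - 1) ≤ t * ((q - 1) * t) :=
        mul_le_mul_of_nonpos_left (by linarith) h
      have h5 : (q - 1) * t ^ 2 * 1 ≤ (q - 1) * t ^ 2 * 2 ^ q :=
        mul_le_mul_of_nonneg_left h2q (mul_nonneg (by linarith) (sq_nonneg t))
      linarith
  have := mul_le_mul_of_nonneg_left key (by linarith : 0 ≤ q)
  linarith

/-- A second order Taylor bound for `x ↦ |x| ^ q`. -/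
lemma exists_abs_add_rpow_le {q : ℝ} (hq : 2 < q) :
    ∃ C : ℝ, 0 < C ∧ ∀ a b : ℝ,
      |a + b| ^ q ≤ |a| ^ q + q * (|a| ^ (q - 2) * a * b)
        + C * (|a| ^ (q - 2) * b ^ 2 + |b| ^ q) := by
  have hq0 : 0 < q := by linarith
  have hC1 : 0 ≤ q * (q - 1) * 2 ^ q := by
    have : 0 ≤ q - 1 := by linarith
    positivity
  -- The first term is the Taylor constant for $|b|\le|a|/2$. Otherwise $|a|<2|b|$: then $3^q$
  -- bounds $|a+b|^q$ and $q2^{q-1}$ the linear term.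
  refine ⟨q * (q - 1) * 2 ^ q + 3 ^ q + q * 2 ^ (q - 1), by positivity, fun a b => ?_⟩
  rcases le_or_gt |b| (|a| / 2) with hb | hb
  · rcases eq_or_ne a 0 with rfl | ha
    · have : b = 0 := by simpa using hb
      subst this
      simp [Real.zero_rpow hq0.ne', Real.zero_rpow (by linarith : q - 2 ≠ 0)]
    have hapos : 0 < |a| := abs_pos.2 ha
    have ht : |b / a| ≤ 1 / 2 := by
      rw [abs_div, div_le_iff₀ hapos]; linarith
    have h1 := one_add_rpow_le_quadratic hq.le ht
    have hnn : 0 ≤ 1 + b / a := by linarith [(abs_le.1 ht).1]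
    have e1 : |a + b| ^ q = |a| ^ q * (1 + b / a) ^ q := by
      rw [← Real.mul_rpow hapos.le hnn, ← abs_of_nonneg hnn, ← abs_mul]
      congr 2
      field_simp
    have e2 : |a| ^ q = |a| ^ (q - 2) * a ^ 2 := by
      rw [← sq_abs, ← Real.rpow_natCast, ← Real.rpow_add hapos]
      norm_num
    have h2 := mul_le_mul_of_nonneg_left h1 (Real.rpow_nonneg hapos.le q)
    have e3 : |a| ^ q * (1 + q * (b / a) + q * (q - 1) * 2 ^ q * (b / a) ^ 2)
        = |a| ^ q + q * (|a| ^ (q - 2) * a * b) + q * (q - 1) * 2 ^ q * (|a| ^ (q - 2) * b ^ 2) := by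
      rw [e2]; field_simp
    rw [e1]
    refine h2.trans (e3.le.trans ?_)
    have h4 : 0 ≤ |a| ^ (q - 2) * b ^ 2 := by positivity
    have h5 : 0 ≤ |b| ^ q := by positivity
    have h6 : 0 ≤ (3 ^ q + q * 2 ^ (q - 1)) * (|a| ^ (q - 2) * b ^ 2 + |b| ^ q) := by positivity
    have h7 := mul_nonneg hC1 h5
    linarith
  · have h1 : |a + b| ^ q ≤ 3 ^ q * |b| ^ q := by
      rw [← Real.mul_rpow (by norm_num) (abs_nonneg b)]
      refine Real.rpow_le_rpow (abs_nonneg _) ?_ hq0.le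
      linarith [abs_add_le a b, abs_nonneg b]
    have h2 : -(|a| ^ (q - 2) * a * b) ≤ 2 ^ (q - 1) * |b| ^ q := by
      have hbpos : 0 < |b| := lt_of_le_of_lt (by positivity) hb
      have e : |b| ^ q = |b| ^ (q - 1) * |b| := by
        rw [← Real.rpow_add_one hbpos.ne']; norm_num
      have h3 : |a| ^ (q - 2) * |a| ≤ 2 ^ (q - 1) * |b| ^ (q - 1) := by
        rw [← Real.mul_rpow (by norm_num) (abs_nonneg b)]
        have : |a| ^ (q - 2) * |a| = |a| ^ (q - 1) := by
          rw [← Real.rpow_add_one' (abs_nonneg a) (by linarith)]; congr 1; ring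
        rw [this]
        exact Real.rpow_le_rpow (abs_nonneg _) (by linarith) (by linarith)
      calc -(|a| ^ (q - 2) * a * b) ≤ |(|a| ^ (q - 2) * a * b)| := neg_le_abs _
        _ = |a| ^ (q - 2) * |a| * |b| := by
            rw [abs_mul, abs_mul, abs_of_nonneg (Real.rpow_nonneg (abs_nonneg a) _)]
        _ ≤ 2 ^ (q - 1) * |b| ^ (q - 1) * |b| := mul_le_mul_of_nonneg_right h3 (abs_nonneg b)
        _ = _ := by rw [e]; ring
    have h3 := mul_le_mul_of_nonneg_left h2 hq0.le
    have h4 : 0 ≤ |a| ^ (q - 2) * b ^ 2 := by positivity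
    have h5 : 0 ≤ |b| ^ q := by positivity
    have h6 : 0 ≤ (3 ^ q + q * 2 ^ (q - 1)) * (|a| ^ (q - 2) * b ^ 2) := by positivity
    have h7 := mul_nonneg hC1 (add_nonneg h4 h5)
    have h8 : 0 ≤ |a| ^ q := by positivity
    linarith

/-- Average of two bounds, each with $2C$ on one error term: superadditivity of $x^{q/2}$ handles
$v^q$, Bernoulli handles $u^{q-2}v^2$. It turns a bound on $q$-th powers into one on squares. -/
lemma rpow_add_le_sq_add_sq_rpow {q C u v : ℝ} (hq : 2 < q) (hC : 0 ≤ C) (hu : 0 ≤ u)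
    (hv : 0 ≤ v) :
    u ^ q + C * (u ^ (q - 2) * v ^ 2 + v ^ q) ≤ (u ^ 2 + (2 * C + 1) * v ^ 2) ^ (q / 2) := by
  have hm : 1 ≤ q / 2 := by linarith
  set K := 2 * C + 1 with hK
  have hK1 : 1 ≤ K := by linarith
  have hKm : K ≤ K ^ (q / 2) := by
    simpa using Real.rpow_le_rpow_of_exponent_le hK1 hm
  have hsq : ∀ {x : ℝ}, 0 ≤ x → (x ^ 2) ^ (q / 2) = x ^ q := fun {x} hx => by
    rw [← Real.rpow_natCast, ← Real.rpow_mul hx]; congr 1; push_cast; ring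
  have hKv : (K * v ^ 2) ^ (q / 2) = K ^ (q / 2) * v ^ q := by
    rw [Real.mul_rpow (by linarith) (by positivity), hsq hv]
  have hvq : 0 ≤ v ^ q := Real.rpow_nonneg hv q
  have hvK : 2 * C * v ^ q ≤ (K * v ^ 2) ^ (q / 2) := by
    rw [hKv]; exact mul_le_mul_of_nonneg_right (by linarith) hvq
  have h1 := Real.add_rpow_le_rpow_add (sq_nonneg u) (by positivity : 0 ≤ K * v ^ 2) hm
  rw [hsq hu] at h1
  have h2 : u ^ q + 2 * C * (u ^ (q - 2) * v ^ 2) ≤ (u ^ 2 + K * v ^ 2) ^ (q / 2) := by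
    rcases hu.eq_or_lt with rfl | hu'
    · rw [Real.zero_rpow (by linarith), Real.zero_rpow (by linarith)]
      simp only [zero_mul, mul_zero, add_zero]; positivity
    · have hB := one_add_mul_self_le_rpow_one_add (s := K * v ^ 2 / u ^ 2)
        (by linarith [show 0 ≤ K * v ^ 2 / u ^ 2 by positivity]) hm
      have e : u ^ 2 + K * v ^ 2 = u ^ 2 * (1 + K * v ^ 2 / u ^ 2) := by field_simp
      have e2 : u ^ q = u ^ (q - 2) * u ^ 2 := by
        rw [← Real.rpow_natCast, ← Real.rpow_add hu']; norm_num
      rw [e, Real.mul_rpow (by positivity) (by positivity), hsq hu]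
      refine le_trans ?_ (mul_le_mul_of_nonneg_left hB (Real.rpow_nonneg hu q))
      have e3 : u ^ q * (1 + q / 2 * (K * v ^ 2 / u ^ 2))
          = u ^ q + q / 2 * K * (u ^ (q - 2) * v ^ 2) := by
        rw [e2]; field_simp
      rw [e3]
      have : 2 * C ≤ q / 2 * K := by nlinarith
      have := mul_le_mul_of_nonneg_right this (by positivity : 0 ≤ u ^ (q - 2) * v ^ 2)
      linarith
  have huq : 0 ≤ u ^ q := Real.rpow_nonneg hu q
  linarith

/-! ### Integrability and Hölder bounds in $L^q$. -/

section LpNorm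

variable {Ω : Type*} [MeasurableSpace Ω] {μ : Measure Ω}

lemma lpNorm_ofReal_rpow {q : ℝ} (hq : 0 < q) {f : Ω → ℝ} (hf : AEStronglyMeasurable f μ) :
    lpNorm f (ENNReal.ofReal q) μ ^ q = ∫ ω, |f ω| ^ q ∂μ := by
  rw [lpNorm_eq_integral_norm_rpow_toReal (by simpa using hq) ENNReal.ofReal_ne_top hf,
    ENNReal.toReal_ofReal hq.le, Real.rpow_inv_rpow (integral_nonneg fun ω => by positivity) hq.ne']
  rfl

lemma MeasureTheory.MemLp.integrable_abs_rpow {q : ℝ} (hq : 0 < q) {f : Ω → ℝ}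
    (hf : MemLp f (ENNReal.ofReal q) μ) : Integrable (fun ω => |f ω| ^ q) μ := by
  simpa [ENNReal.toReal_ofReal hq.le] using
    hf.integrable_norm_rpow (by simpa using hq) ENNReal.ofReal_ne_top

lemma MeasureTheory.MemLp.abs_rpow {q s : ℝ} (hs : 0 < s) {f : Ω → ℝ}
    (hf : MemLp f (ENNReal.ofReal q) μ) :
    MemLp (fun ω => |f ω| ^ s) (ENNReal.ofReal (q / s)) μ := by
  have := hf.norm_rpow_div (ENNReal.ofReal s)
  rwa [ENNReal.toReal_ofReal hs.le, ← ENNReal.ofReal_div_of_pos hs] at this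

/-- Hölder's inequality for `|a| ^ (q - 2) * b ^ 2`. -/
lemma integral_abs_rpow_mul_sq_le {q : ℝ} (hq : 2 < q) {a b : Ω → ℝ}
    (ha : MemLp a (ENNReal.ofReal q) μ) (hb : MemLp b (ENNReal.ofReal q) μ) :
    ∫ ω, |a ω| ^ (q - 2) * b ω ^ 2 ∂μ
      ≤ lpNorm a (ENNReal.ofReal q) μ ^ (q - 2) * lpNorm b (ENNReal.ofReal q) μ ^ 2 := by
  have h2 : 0 < q - 2 := by linarith
  have hq0 : 0 < q := by linarith
  have hpq : (q / (q - 2)).HolderConjugate (q / 2) := by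
    rw [Real.holderConjugate_iff]
    refine ⟨by rw [lt_div_iff₀ h2]; linarith, by field_simp; ring⟩
  have hA := ha.abs_rpow h2
  have hB := hb.abs_rpow (two_pos)
  have key := integral_mul_le_Lp_mul_Lq_of_nonneg hpq
    (Eventually.of_forall fun ω => by positivity) (Eventually.of_forall fun ω => by positivity) hA hB
  have e1 : ∀ x : ℝ, (|x| ^ (q - 2)) ^ (q / (q - 2)) = |x| ^ q := fun x => by
    rw [← Real.rpow_mul (abs_nonneg x), mul_div_cancel₀ _ h2.ne']
  have e2 : ∀ x : ℝ, (|x| ^ (2 : ℝ)) ^ (q / 2) = |x| ^ q := fun x => by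
    rw [← Real.rpow_mul (abs_nonneg x), mul_div_cancel₀ _ two_ne_zero]
  simp only [e1, e2] at key
  rw [← lpNorm_ofReal_rpow hq0 ha.1, ← lpNorm_ofReal_rpow hq0 hb.1, ← Real.rpow_mul lpNorm_nonneg,
    ← Real.rpow_mul lpNorm_nonneg] at key
  have e3 : q * (1 / (q / (q - 2))) = q - 2 := by field_simp
  have e4 : q * (1 / (q / 2)) = (2 : ℕ) := by field_simp; norm_num
  rw [e3, e4, Real.rpow_natCast] at key
  simpa using key

lemma abs_rpow_mul_abs_rpow_le {q s t x y : ℝ} (hs : 0 ≤ s) (ht : 0 ≤ t) (hst : s + t = q) (hq : 0 < q) :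
    |x| ^ s * |y| ^ t ≤ |x| ^ q + |y| ^ q := by
  have hx := abs_nonneg x
  have hy := abs_nonneg y
  have hm : 0 ≤ max |x| |y| := hx.trans (le_max_left _ _)
  calc |x| ^ s * |y| ^ t ≤ max |x| |y| ^ s * max |x| |y| ^ t := by
        gcongr
        · exact le_max_left _ _
        · exact le_max_right _ _
    _ = max |x| |y| ^ q := by rw [← Real.rpow_add' hm (by rw [hst]; exact hq.ne'), hst]
    _ ≤ _ := by
        rcases max_choice |x| |y| with h | h <;> rw [h]
        · linarith [Real.rpow_nonneg hy q]
        · linarith [Real.rpow_nonneg hx q]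

lemma integrable_abs_rpow_mul {q : ℝ} (hq : 2 < q) {a b : Ω → ℝ}
    (ha : MemLp a (ENNReal.ofReal q) μ) (hb : MemLp b (ENNReal.ofReal q) μ) :
    Integrable (fun ω => |a ω| ^ (q - 2) * a ω * b ω) μ := by
  have hq0 : 0 < q := by linarith
  have hm := ha.1.aemeasurable
  have hm' := hb.1.aemeasurable
  refine ((ha.integrable_abs_rpow hq0).add (hb.integrable_abs_rpow hq0)).mono'
    (by fun_prop) (Eventually.of_forall fun ω => ?_)
  have h := abs_rpow_mul_abs_rpow_le (x := a ω) (y := b ω) (s := q - 1) (t := 1) (q := q)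
    (by linarith) (by linarith) (by ring) hq0
  refine le_trans (le_of_eq ?_) h
  rw [Real.norm_eq_abs, abs_mul, abs_mul, abs_of_nonneg (Real.rpow_nonneg (abs_nonneg _) _),
    Real.rpow_one, ← Real.rpow_add_one' (abs_nonneg _) (by linarith)]
  congr 2; ring

lemma integrable_abs_rpow_mul_sq {q : ℝ} (hq : 2 < q) {a b : Ω → ℝ}
    (ha : MemLp a (ENNReal.ofReal q) μ) (hb : MemLp b (ENNReal.ofReal q) μ) :
    Integrable (fun ω => |a ω| ^ (q - 2) * b ω ^ 2) μ := by
  have hq0 : 0 < q := by linarith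
  have hm := ha.1.aemeasurable
  have hm' := hb.1.aemeasurable
  refine ((ha.integrable_abs_rpow hq0).add (hb.integrable_abs_rpow hq0)).mono'
    (by fun_prop) (Eventually.of_forall fun ω => ?_)
  have h := abs_rpow_mul_abs_rpow_le (x := a ω) (y := b ω) (s := q - 2) (t := 2) (q := q)
    (by linarith) (by linarith) (by ring) hq0
  refine le_trans (le_of_eq ?_) h
  rw [Real.norm_of_nonneg (by positivity), Real.rpow_two, sq_abs]

end LpNorm

/-! ### Smoothness of the $L^q$ norm. -/

/-- Martingale-type inequality in `L^q`: adding an increment `b` that is orthogonal to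
`|a| ^ (q - 2) * a` increases the squared `L^q` norm by at most a multiple of that of `b`. -/
lemma exists_sq_lpNorm_add_le.{u} {q : ℝ} (hq : 2 < q) :
    ∃ K : ℝ, 0 < K ∧ ∀ {Ω : Type u} [MeasurableSpace Ω] {μ : Measure Ω} {a b : Ω → ℝ},
      MemLp a (ENNReal.ofReal q) μ → MemLp b (ENNReal.ofReal q) μ →
      ∫ ω, |a ω| ^ (q - 2) * a ω * b ω ∂μ = 0 →
      lpNorm (a + b) (ENNReal.ofReal q) μ ^ 2
        ≤ lpNorm a (ENNReal.ofReal q) μ ^ 2 + K * lpNorm b (ENNReal.ofReal q) μ ^ 2 := by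
  obtain ⟨C, hC, hTaylor⟩ := exists_abs_add_rpow_le hq
  have hq0 : 0 < q := by linarith
  refine ⟨2 * C + 1, by positivity, fun {Ω} _ {μ a b} ha hb h0 => ?_⟩
  set u := lpNorm a (ENNReal.ofReal q) μ with hu
  set v := lpNorm b (ENNReal.ofReal q) μ with hv
  have hu0 : 0 ≤ u := lpNorm_nonneg
  have hv0 : 0 ≤ v := lpNorm_nonneg
  have iA := ha.integrable_abs_rpow hq0
  have iB := hb.integrable_abs_rpow hq0
  have iM := integrable_abs_rpow_mul hq ha hb
  have iS := integrable_abs_rpow_mul_sq hq ha hb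
  have iAM : Integrable (fun ω => |a ω| ^ q + q * (|a ω| ^ (q - 2) * a ω * b ω)) μ :=
    iA.add (iM.const_mul q)
  have iSB : Integrable (fun ω => C * (|a ω| ^ (q - 2) * b ω ^ 2 + |b ω| ^ q)) μ :=
    (iS.add iB).const_mul C
  have h1 : lpNorm (a + b) (ENNReal.ofReal q) μ ^ q
      ≤ u ^ q + C * (u ^ (q - 2) * v ^ 2 + v ^ q) := by
    rw [lpNorm_ofReal_rpow hq0 (ha.1.add hb.1)]
    calc ∫ ω, |(a + b) ω| ^ q ∂μ
        ≤ ∫ ω, (|a ω| ^ q + q * (|a ω| ^ (q - 2) * a ω * b ω)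
            + C * (|a ω| ^ (q - 2) * b ω ^ 2 + |b ω| ^ q)) ∂μ :=
          integral_mono ((ha.add hb).integrable_abs_rpow hq0)
            (iAM.add iSB) fun ω => hTaylor _ _
      _ = u ^ q + C * (∫ ω, |a ω| ^ (q - 2) * b ω ^ 2 ∂μ + v ^ q) := by
          rw [integral_add iAM iSB,
            integral_add iA (iM.const_mul q), integral_const_mul, integral_const_mul,
            integral_add iS iB, h0, hu, hv, lpNorm_ofReal_rpow hq0 ha.1,
            lpNorm_ofReal_rpow hq0 hb.1, mul_zero, add_zero]
      _ ≤ _ := by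
          gcongr
          exact integral_abs_rpow_mul_sq_le hq ha hb
  have h2 := h1.trans (rpow_add_le_sq_add_sq_rpow hq hC.le hu0 hv0)
  set w := lpNorm (a + b) (ENNReal.ofReal q) μ
  have hw0 : 0 ≤ w := lpNorm_nonneg
  have e : w ^ q = (w ^ 2) ^ (q / 2) := by
    rw [← Real.rpow_natCast, ← Real.rpow_mul hw0]; congr 1; push_cast; ring
  rw [e] at h2
  exact (Real.rpow_le_rpow_iff (by positivity) (by positivity) (by positivity)).1 h2

/-! ### Orthogonality from independence, and products in $L^q$. -/

section Independence

variable {Ω ι : Type*} [MeasurableSpace Ω] {μ : Measure Ω}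

/-- The expectation factors, and the factor at the new index $i$ vanishes. `G` lets callers write
sums over `s` instead of over its subtype. -/
lemma integral_mul_eq_zero_of_notMem {X : ι → Ω → ℝ} (hX : iIndepFun X μ)
    (hm : ∀ i, AEMeasurable (X i) μ) {s : Finset ι} {i : ι} (hi : i ∉ s)
    {g : (s → ℝ) → ℝ} (hg : Measurable g) {G : Ω → ℝ} (hG : ∀ ω, g (fun k => X k ω) = G ω) {h : ℝ → ℝ} (hh : Measurable h)
    (h0 : ∫ ω, h (X i ω) ∂μ = 0) :
    ∫ ω, G ω * h (X i ω) ∂μ = 0 := by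
  have hind := hX.indepFun_finset₀ s {i} (Finset.disjoint_singleton_right.2 hi) hm
  have hind' := hind.comp hg
    (hh.comp (measurable_pi_apply (⟨i, Finset.mem_singleton_self i⟩ : ({i} : Finset ι))))
  have hms : AEMeasurable (fun ω (k : s) => X k ω) μ := aemeasurable_pi_lambda _ fun k => hm k
  have := hind'.integral_fun_mul_eq_mul_integral
    (hg.comp_aemeasurable hms).aestronglyMeasurable (hh.comp_aemeasurable (hm i)).aestronglyMeasurable
  simp only [Function.comp_apply, hG, h0, mul_zero] at this
  exact this

lemma holderTriple_ofReal_two_mul {q : ℝ} (hq : 0 < q) :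
    ENNReal.HolderTriple (ENNReal.ofReal (2 * q)) (ENNReal.ofReal (2 * q)) (ENNReal.ofReal q) := by
  constructor
  rw [← ENNReal.ofReal_inv_of_pos (by positivity), ← ENNReal.ofReal_inv_of_pos hq,
    ← ENNReal.ofReal_add (by positivity) (by positivity)]
  congr 1
  field_simp
  norm_num

lemma memLp_mul_of_two_mul {q : ℝ} (hq : 0 < q) {f g : Ω → ℝ}
    (hf : MemLp f (ENNReal.ofReal (2 * q)) μ) (hg : MemLp g (ENNReal.ofReal (2 * q)) μ) :
    MemLp (fun ω => f ω * g ω) (ENNReal.ofReal q) μ :=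
  have := holderTriple_ofReal_two_mul hq
  MemLp.mul hg hf

/-- The Cauchy–Schwarz inequality for `L^q` norms. -/
lemma lpNorm_mul_le_of_two_mul {q : ℝ} (hq : 0 < q) {f g : Ω → ℝ}
    (hf : MemLp f (ENNReal.ofReal (2 * q)) μ) (hg : MemLp g (ENNReal.ofReal (2 * q)) μ) :
    lpNorm (fun ω => f ω * g ω) (ENNReal.ofReal q) μ
      ≤ lpNorm f (ENNReal.ofReal (2 * q)) μ * lpNorm g (ENNReal.ofReal (2 * q)) μ := by
  have := holderTriple_ofReal_two_mul hq
  rw [← toReal_eLpNorm (memLp_mul_of_two_mul hq hf hg).1, ← toReal_eLpNorm hf.1,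
    ← toReal_eLpNorm hg.1, ← ENNReal.toReal_mul]
  have h := eLpNorm_smul_le_mul_eLpNorm (p := ENNReal.ofReal (2 * q)) (q := ENNReal.ofReal (2 * q))
    (r := ENNReal.ofReal q) hg.1 hf.1
  exact ENNReal.toReal_mono (ENNReal.mul_ne_top hf.2.ne hg.2.ne) h

lemma lpNorm_fun_const_mul (c : ℝ) (f : Ω → ℝ) (p : ℝ≥0∞) :
    lpNorm (fun ω => c * f ω) p μ = |c| * lpNorm f p μ := by
  have := lpNorm_const_smul (p := p) c f μ
  rwa [coe_nnnorm, Real.norm_eq_abs] at this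

end Independence

/-! ### Linear and quadratic forms. -/

/-- Marcinkiewicz–Zygmund type bound for linear forms in independent centred variables. -/
lemma exists_sq_lpNorm_sum_mul_le.{u} {q : ℝ} (hq : 2 < q) :
    ∃ K : ℝ, 0 < K ∧ ∀ {Ω : Type u} [MeasurableSpace Ω] {μ : Measure Ω} {ι : Type} {X : ι → Ω → ℝ}
      {κ : ℝ}, iIndepFun X μ → (∀ i, MemLp (X i) (ENNReal.ofReal q) μ) →
      (∀ i, ∫ ω, X i ω ∂μ = 0) → (∀ i, lpNorm (X i) (ENNReal.ofReal q) μ ≤ κ) →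
      ∀ (c : ι → ℝ) (s : Finset ι),
        lpNorm (fun ω => ∑ k ∈ s, c k * X k ω) (ENNReal.ofReal q) μ ^ 2
          ≤ K * κ ^ 2 * ∑ k ∈ s, c k ^ 2 := by
  obtain ⟨K, hK, hstep⟩ := exists_sq_lpNorm_add_le.{u} hq
  refine ⟨K, hK, fun {Ω} _ {μ ι X κ} hX hL h0 hκ c s => ?_⟩
  classical
  have hm : ∀ i, AEMeasurable (X i) μ := fun i => (hL i).1.aemeasurable
  induction s using Finset.induction_on with
  | empty => simp
  | insert i s hi ih =>
    have ha : MemLp (fun ω => ∑ k ∈ s, c k * X k ω) (ENNReal.ofReal q) μ :=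
      memLp_finsetSum s fun k _ => (hL k).const_mul (c k)
    have hb : MemLp (fun ω => c i * X i ω) (ENNReal.ofReal q) μ := (hL i).const_mul (c i)
    have hcoe : ∀ ω, ∑ k : s, c k * X k ω = ∑ k ∈ s, c k * X k ω := fun ω =>
      Finset.sum_coe_sort s fun k => c k * X k ω
    have horth := integral_mul_eq_zero_of_notMem hX hm hi
      (g := fun x => |∑ k : s, c k * x k| ^ (q - 2) * ∑ k : s, c k * x k) (by fun_prop)
      (G := fun ω => |∑ k ∈ s, c k * X k ω| ^ (q - 2) * ∑ k ∈ s, c k * X k ω)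
      (fun ω => by simp only [hcoe])
      (h := fun x => c i * x) (by fun_prop) (by rw [integral_const_mul, h0, mul_zero])
    have h1 := hstep ha hb horth
    have e : (fun ω => ∑ k ∈ insert i s, c k * X k ω)
        = (fun ω => ∑ k ∈ s, c k * X k ω) + fun ω => c i * X i ω := by
      ext ω; rw [Finset.sum_insert hi, Pi.add_apply, add_comm]
    rw [e, Finset.sum_insert hi]
    have h2 : lpNorm (fun ω => c i * X i ω) (ENNReal.ofReal q) μ ^ 2 ≤ c i ^ 2 * κ ^ 2 := by
      rw [lpNorm_fun_const_mul, mul_pow, sq_abs]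
      have := hκ i
      have := lpNorm_nonneg (f := X i) (p := ENNReal.ofReal q) (μ := μ)
      gcongr
    have h3 := mul_le_mul_of_nonneg_left h2 hK.le
    linarith

/-- Moment bound for quadratic forms in independent standardized variables, in terms of the
Frobenius norm. -/
lemma exists_sq_lpNorm_quadForm_le.{u} {q : ℝ} (hq : 2 < q) :
    ∃ K : ℝ, 0 < K ∧ ∀ {Ω : Type u} [MeasurableSpace Ω] {μ : Measure Ω} [IsProbabilityMeasure μ]
      {ι : Type} {X : ι → Ω → ℝ} {κ : ℝ}, iIndepFun X μ →
      (∀ i, MemLp (X i) (ENNReal.ofReal (2 * q)) μ) →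
      (∀ i, ∫ ω, X i ω ∂μ = 0) → (∀ i, ∫ ω, X i ω ^ 2 ∂μ = 1) → 1 ≤ κ →
      (∀ i, lpNorm (X i) (ENNReal.ofReal (2 * q)) μ ≤ κ) →
      ∀ (A : Matrix ι ι ℝ) (s : Finset ι),
        MemLp (fun ω => ∑ j ∈ s, ∑ k ∈ s, A j k * (X j ω * X k ω) - ∑ j ∈ s, A j j)
          (ENNReal.ofReal q) μ ∧
        lpNorm (fun ω => ∑ j ∈ s, ∑ k ∈ s, A j k * (X j ω * X k ω) - ∑ j ∈ s, A j j)
          (ENNReal.ofReal q) μ ^ 2 ≤ K * κ ^ 4 * ∑ j ∈ s, ∑ k ∈ s, A j k ^ 2 := by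
  obtain ⟨K, hK, hstep⟩ := exists_sq_lpNorm_add_le.{u} hq
  obtain ⟨K₂, hK₂, hlin⟩ := exists_sq_lpNorm_sum_mul_le.{u} (q := 2 * q) (by linarith)
  -- With $(x+y)^2\le2x^2+2y^2$, the diagonal part gives $2(2\kappa^2)^2=8\kappa^4$. The cross part
  -- gives $2\kappa^2\cdot K_2\kappa^2\cdot2$, the last 2 from splitting $(A_{ik}+A_{ki})^2$.
  refine ⟨K * (8 + 4 * K₂), by positivity,
    fun {Ω} _ {μ} _ {ι X κ} hX hL h0 h1 hκ1 hκ A s => ?_⟩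
  classical
  have hq0 : 0 < q := by linarith
  have hq1 : 1 ≤ ENNReal.ofReal q := by
    rw [ENNReal.one_le_ofReal]; linarith
  have hm : ∀ i, AEMeasurable (X i) μ := fun i => (hL i).1.aemeasurable
  have hLmul : ∀ j k, MemLp (fun ω => X j ω * X k ω) (ENNReal.ofReal q) μ := fun j k =>
    memLp_mul_of_two_mul hq0 (hL j) (hL k)
  have hmem : ∀ s : Finset ι,
      MemLp (fun ω => ∑ j ∈ s, ∑ k ∈ s, A j k * (X j ω * X k ω) - ∑ j ∈ s, A j j)
        (ENNReal.ofReal q) μ := fun s =>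
    (memLp_finsetSum s fun j _ => memLp_finsetSum s fun k _ =>
      (hLmul j k).const_mul (A j k)).sub (memLp_const _)
  refine ⟨hmem s, ?_⟩
  induction s using Finset.induction_on with
  | empty => simp
  | insert i s hi ih =>
    set Q : Ω → ℝ := fun ω => ∑ j ∈ s, ∑ k ∈ s, A j k * (X j ω * X k ω) - ∑ j ∈ s, A j j with hQ
    set L : Ω → ℝ := fun ω => ∑ k ∈ s, (A i k + A k i) * X k ω with hLdef
    set D : Ω → ℝ := fun ω => A i i * (X i ω * X i ω - 1) with hD
    set P : Ω → ℝ := fun ω => X i ω * L ω with hP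
    have hLm : MemLp L (ENNReal.ofReal (2 * q)) μ :=
      memLp_finsetSum s fun k _ => (hL k).const_mul _
    have hDm : MemLp D (ENNReal.ofReal q) μ :=
      ((hLmul i i).sub (memLp_const (1 : ℝ))).const_mul _
    have hPm : MemLp P (ENNReal.ofReal q) μ := memLp_mul_of_two_mul hq0 (hL i) hLm
    have e : (fun ω => ∑ j ∈ insert i s, ∑ k ∈ insert i s, A j k * (X j ω * X k ω)
        - ∑ j ∈ insert i s, A j j) = Q + (D + P) := by
      ext ω
      simp only [hQ, hD, hP, hLdef, Pi.add_apply, Finset.sum_insert hi, Finset.sum_add_distrib,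
        Finset.mul_sum, add_mul, mul_add]
      have : ∀ k, A i k * (X i ω * X k ω) = X i ω * (A i k * X k ω) := fun k => by ring
      have h' : ∀ k, A k i * (X k ω * X i ω) = X i ω * (A k i * X k ω) := fun k => by ring
      simp only [this, h']
      ring
    have hcoeQ : ∀ ω, ∑ j : s, ∑ k : s, A j k * (X j ω * X k ω) - ∑ j : s, A j j = Q ω := fun ω => by
      have h (j : ι) := Finset.sum_coe_sort s fun k => A j k * (X j ω * X k ω)
      simp only [h, Finset.sum_coe_sort s fun j => ∑ k ∈ s, A j k * (X j ω * X k ω),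
        Finset.sum_coe_sort s fun j => A j j, hQ]
    have hcoeL : ∀ ω, ∑ k : s, (A i k + A k i) * X k ω = L ω := fun ω =>
      Finset.sum_coe_sort s fun k => (A i k + A k i) * X k ω
    have horthD : ∫ ω, |Q ω| ^ (q - 2) * Q ω * D ω ∂μ = 0 := by
      have := integral_mul_eq_zero_of_notMem hX hm hi
        (g := fun x => |∑ j : s, ∑ k : s, A j k * (x j * x k) - ∑ j : s, A j j| ^ (q - 2)
          * (∑ j : s, ∑ k : s, A j k * (x j * x k) - ∑ j : s, A j j)) (by fun_prop)
        (G := fun ω => |Q ω| ^ (q - 2) * Q ω) (fun ω => by simp only [hcoeQ])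
        (h := fun x => A i i * (x * x - 1)) (by fun_prop) (by
          -- A non-integrable function has integral 0 by convention, which contradicts the value 1.
          have hint : Integrable (fun ω => X i ω ^ 2) μ := by
            by_contra hcon
            have := h1 i
            rw [integral_undef hcon] at this
            norm_num at this
          simp only [← pow_two]
          rw [integral_const_mul, integral_sub hint (integrable_const _), h1]
          simp)
      exact this
    -- $L$ depends only on the earlier variables, so it joins the factor in $Q$ and leaves $X_i$
    -- alone.
    have horthP : ∫ ω, |Q ω| ^ (q - 2) * Q ω * P ω ∂μ = 0 := by
      have := integral_mul_eq_zero_of_notMem hX hm hi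
        (g := fun x => |∑ j : s, ∑ k : s, A j k * (x j * x k) - ∑ j : s, A j j| ^ (q - 2)
          * (∑ j : s, ∑ k : s, A j k * (x j * x k) - ∑ j : s, A j j)
          * ∑ k : s, (A i k + A k i) * x k) (by fun_prop)
        (G := fun ω => |Q ω| ^ (q - 2) * Q ω * L ω) (fun ω => by simp only [hcoeQ, hcoeL])
        (h := fun x => x) (by fun_prop) (h0 i)
      rw [← this]
      congr 1; ext ω; simp only [hP]; ring
    have horth : ∫ ω, |Q ω| ^ (q - 2) * Q ω * (D + P) ω ∂μ = 0 := by
      simp only [Pi.add_apply, mul_add]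
      rw [integral_add (integrable_abs_rpow_mul hq (hmem s) hDm)
        (integrable_abs_rpow_mul hq (hmem s) hPm), horthD, horthP, add_zero]
    have hkey := hstep (hmem s) (hDm.add hPm) horth
    have hDn : lpNorm D (ENNReal.ofReal q) μ ≤ |A i i| * (2 * κ ^ 2) := by
      rw [hD, lpNorm_fun_const_mul]
      gcongr
      have h2 : lpNorm (fun ω => X i ω * X i ω) (ENNReal.ofReal q) μ ≤ κ ^ 2 := by
        rw [pow_two]
        exact (lpNorm_mul_le_of_two_mul hq0 (hL i) (hL i)).trans
          (mul_le_mul (hκ i) (hκ i) lpNorm_nonneg (by linarith))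
      have h3 := lpNorm_sub_le (g := fun _ => (1 : ℝ)) (hLmul i i) hq1
      have h4 : lpNorm (fun _ : Ω => (1 : ℝ)) (ENNReal.ofReal q) μ = 1 := by
        rw [lpNorm_const (by simpa using hq0) (IsProbabilityMeasure.ne_zero μ)]
        simp
      rw [h4] at h3
      refine h3.trans ?_
      -- $\kappa^2+1\le2\kappa^2$, since $\kappa\ge1$.
      nlinarith
    have hPn : lpNorm P (ENNReal.ofReal q) μ ≤ κ * lpNorm L (ENNReal.ofReal (2 * q)) μ :=
      (lpNorm_mul_le_of_two_mul hq0 (hL i) hLm).trans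
        (mul_le_mul_of_nonneg_right (hκ i) lpNorm_nonneg)
    have hLn := hlin hX hL h0 hκ (fun k => A i k + A k i) s
    have hb : lpNorm (D + P) (ENNReal.ofReal q) μ ^ 2
        ≤ 8 * κ ^ 4 * A i i ^ 2
          + 2 * κ ^ 2 * lpNorm L (ENNReal.ofReal (2 * q)) μ ^ 2 := by
      have h2 := (lpNorm_add_le (g := P) hDm hq1).trans (add_le_add hDn hPn)
      have h3 := pow_le_pow_left₀ lpNorm_nonneg h2 2
      refine h3.trans ((add_sq_le).trans (le_of_eq ?_))
      rw [mul_pow, sq_abs]; ring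
    have hsum : ∑ k ∈ s, (A i k + A k i) ^ 2 ≤ 2 * (∑ k ∈ s, A i k ^ 2 + ∑ k ∈ s, A k i ^ 2) := by
      rw [← Finset.sum_add_distrib, Finset.mul_sum]
      exact Finset.sum_le_sum fun k _ => add_sq_le
    have hfrob : ∑ j ∈ insert i s, ∑ k ∈ insert i s, A j k ^ 2
        = ∑ j ∈ s, ∑ k ∈ s, A j k ^ 2
          + (A i i ^ 2 + (∑ k ∈ s, A i k ^ 2 + ∑ k ∈ s, A k i ^ 2)) := by
      simp only [Finset.sum_insert hi, Finset.sum_add_distrib]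
      ring
    rw [e, hfrob]
    set F := ∑ k ∈ s, A i k ^ 2 + ∑ k ∈ s, A k i ^ 2 with hF
    have hF0 : 0 ≤ F := by positivity
    have hinc : lpNorm (D + P) (ENNReal.ofReal q) μ ^ 2
        ≤ (8 + 4 * K₂) * κ ^ 4 * (A i i ^ 2 + F) := by
      have h5 : 2 * κ ^ 2 * lpNorm L (ENNReal.ofReal (2 * q)) μ ^ 2
          ≤ 2 * κ ^ 2 * (K₂ * κ ^ 2 * (2 * F)) :=
        mul_le_mul_of_nonneg_left (hLn.trans (by gcongr)) (by positivity)
      have h6 : 0 ≤ 4 * K₂ * κ ^ 4 * A i i ^ 2 := by positivity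
      have h7 : 0 ≤ 8 * κ ^ 4 * F := by positivity
      linarith
    have h8 := mul_le_mul_of_nonneg_left hinc hK.le
    linarith

/-! ### From the Frobenius norm to the spectral norm, and conclusion. -/

lemma sum_sq_col_le_sq_spectralNorm2 {p : ℕ} (A : Matrix (Fin p) (Fin p) ℝ) (k : Fin p) :
    ∑ j, A j k ^ 2 ≤ spectralNorm2 A ^ 2 := by
  have h := (Matrix.toEuclideanCLM (n := Fin p) (𝕜 := ℝ) A).le_opNorm (EuclideanSpace.single k 1)
  rw [PiLp.norm_single, norm_one, mul_one] at h
  have h2 := pow_le_pow_left₀ (norm_nonneg _) h 2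
  rw [EuclideanSpace.norm_sq_eq] at h2
  refine le_trans (le_of_eq ?_) h2
  refine Finset.sum_congr rfl fun j _ => ?_
  rw [Real.norm_eq_abs, sq_abs]
  congr 1
  simp [Matrix.ofLp_toEuclideanCLM, Matrix.mulVec_single]

lemma lpNorm_eq_momentNorm {Ω : Type*} [MeasurableSpace Ω] {μ : Measure Ω} {q : ℝ} (hq : 0 < q)
    {f : Ω → ℝ} (hf : AEStronglyMeasurable f μ) :
    lpNorm f (ENNReal.ofReal q) μ = momentNorm μ q f := by
  rw [momentNorm, ← lpNorm_ofReal_rpow hq hf, one_div, Real.rpow_rpow_inv lpNorm_nonneg hq.ne']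

/-- On a probability space $L^q$ norms increase with $q$, and the $L^2$ norm is 1. -/
lemma one_le_lpNorm_of_integral_sq_eq_one {Ω : Type*} [MeasurableSpace Ω] {μ : Measure Ω}
    [IsProbabilityMeasure μ] {q : ℝ} (hq : 2 ≤ q) {f : Ω → ℝ}
    (hf : MemLp f (ENNReal.ofReal q) μ) (h1 : ∫ ω, f ω ^ 2 ∂μ = 1) :
    1 ≤ lpNorm f (ENNReal.ofReal q) μ := by
  have h2 : lpNorm f (ENNReal.ofReal 2) μ = 1 := by
    have := lpNorm_ofReal_rpow two_pos hf.1
    simp only [Real.rpow_two, sq_abs, h1] at this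
    nlinarith [lpNorm_nonneg (f := f) (p := ENNReal.ofReal 2) (μ := μ)]
  rw [← h2, ← toReal_eLpNorm hf.1, ← toReal_eLpNorm hf.1]
  exact ENNReal.toReal_mono hf.2.ne
    (eLpNorm_le_eLpNorm_of_exponent_le (ENNReal.ofReal_le_ofReal hq) hf.1)

lemma absPow_nonneg (a r : ℝ) : 0 ≤ absPow a r := by
  unfold absPow
  split_ifs
  · exact le_rfl
  · positivity

theorem corollary1 (q r C₀ : ℝ) (hq : 2 < q) (hr₀ : 0 ≤ r) (hr₁ : r < 1) (hC₀ : 0 < C₀) :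
    ∃ C : ℝ, 0 < C ∧
      ∀ M : ℕ → ℝ, Tendsto M atTop atTop →
      ∀ (p : ℕ) [NeZero p] (Ω : Type*) [MeasurableSpace Ω] (μ : Measure Ω)
        [IsProbabilityMeasure μ] (X : Fin p → Ω → ℝ),
        iIndepFun X μ →
        (∀ j, IdentDistrib (X j) (X 0) μ μ) →
        (∀ j, MemLp (X j) (ENNReal.ofReal (2 * q)) μ) →
        (∀ j, ∫ ω, X j ω ∂μ = 0) →
        (∀ j, ∫ ω, X j ω ^ 2 ∂μ = 1) →
        (⨆ A ∈ sparseClass p r C₀ (M p), quadFormMoment μ X A q) ≤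
          ENNReal.ofReal (C * momentNorm μ (2 * q) (X 0) ^ (2 * q) *
            ((p : ℝ) ^ (q / 2) + (p : ℝ) ^ (1 / 2 : ℝ) * M p ^ (q / 2))) := by
  obtain ⟨K, hK, hquad⟩ := exists_sq_lpNorm_quadForm_le hq
  have hq0 : 0 < q := by linarith
  refine ⟨(K * C₀ ^ 2) ^ (q / 2), by positivity, ?_⟩
  intro M _ p _ Ω _ μ _ X hX hid hL h0 h1
  refine iSup₂_le fun A ⟨_, hspec, hcol⟩ => ?_
  -- Nonnegativity of `M p` makes the second summand of the bound nonnegative, so it can be added at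
  -- the end.
  have hM : 0 ≤ M p := (Finset.sum_nonneg fun j _ => absPow_nonneg (A j 0) r).trans (hcol 0)
  set κ := momentNorm μ (2 * q) (X 0) with hκdef
  have hκ0 : lpNorm (X 0) (ENNReal.ofReal (2 * q)) μ = κ :=
    lpNorm_eq_momentNorm (by linarith) (hL 0).1
  have hκ : ∀ j, lpNorm (X j) (ENNReal.ofReal (2 * q)) μ ≤ κ := fun j => by
    rw [← hκ0, ← toReal_eLpNorm (hL j).1, ← toReal_eLpNorm (hL 0).1, (hid j).eLpNorm_eq]
  have hκ1 : 1 ≤ κ := hκ0 ▸ one_le_lpNorm_of_integral_sq_eq_one (by linarith) (hL 0) (h1 0)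
  obtain ⟨hmem, hbound⟩ := hquad hX hL h0 h1 hκ1 hκ A Finset.univ
  set f : Ω → ℝ := fun ω => ∑ j, ∑ k, A j k * (X j ω * X k ω) - ∑ j, A j j with hf
  have hfrob : ∑ j, ∑ k, A j k ^ 2 ≤ p * C₀ ^ 2 := by
    rw [Finset.sum_comm]
    calc ∑ k, ∑ j, A j k ^ 2 ≤ ∑ _k : Fin p, C₀ ^ 2 := Finset.sum_le_sum fun k _ =>
          (sum_sq_col_le_sq_spectralNorm2 A k).trans (pow_le_pow_left₀ (norm_nonneg _) hspec 2)
      _ = p * C₀ ^ 2 := by simp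
  have hform : quadFormMoment μ X A q = ENNReal.ofReal (∫ ω, |f ω| ^ q ∂μ) := by
    rw [ofReal_integral_eq_lintegral_ofReal (hmem.integrable_abs_rpow hq0)
      (Eventually.of_forall fun ω => by positivity), quadFormMoment]
    refine lintegral_congr fun ω => ?_
    congr 3
    simp only [hf, dotProduct, Matrix.mulVec, Matrix.trace, Matrix.diag_apply, Finset.mul_sum]
    congr 1
    exact Finset.sum_congr rfl fun j _ => Finset.sum_congr rfl fun k _ => by ring
  rw [hform, ← lpNorm_ofReal_rpow hq0 hmem.1]
  refine ENNReal.ofReal_le_ofReal ?_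
  have hrpow : ∀ {x : ℝ} (n : ℕ), 0 ≤ x → (x ^ n) ^ (q / 2) = x ^ (n * (q / 2)) :=
    fun {x} n hx => by rw [← Real.rpow_natCast, ← Real.rpow_mul hx]
  calc lpNorm f (ENNReal.ofReal q) μ ^ q
      = (lpNorm f (ENNReal.ofReal q) μ ^ 2) ^ (q / 2) := by
        rw [hrpow 2 lpNorm_nonneg]; congr 1; push_cast; ring
    _ ≤ (K * κ ^ 4 * (p * C₀ ^ 2)) ^ (q / 2) := by
        refine Real.rpow_le_rpow (by positivity) (hbound.trans ?_) (by positivity)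
        gcongr
    _ = (K * C₀ ^ 2) ^ (q / 2) * κ ^ (2 * q) * (p : ℝ) ^ (q / 2) := by
        rw [show K * κ ^ 4 * (p * C₀ ^ 2) = K * C₀ ^ 2 * κ ^ 4 * p by ring,
          Real.mul_rpow (by positivity) (by positivity),
          Real.mul_rpow (by positivity) (by positivity), hrpow 4 (by linarith)]
        congr 3; push_cast; ring
    _ ≤ _ := by
        gcongr
        exact le_add_of_nonneg_right (by positivity)
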